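/- Let $p$ be a prime, let $a\ge 1$ be an integer with $p^a\equiv 1 \pmod 4$, and let $\mathrm{Paley}(p^a)$ be the Paley graph: its vertex set is the finite field $\mathrm{GF}(p^a)$, and two vertices $x,y$ are adjacent if and only if $y-x$ is a nonzero square. Let $G_0$ be the stabilizer of the vertex $0$ in the automorphism group of $\mathrm{Paley}(p^a)$, and let $$\mathcal T_4(\mathrm{Paley}(p^a))=\{M\in M_{\mathrm{GF}(p^a)}(\mathbb C) : M_{\sigma(x),\sigma(y)}=M_{x,y}\text{ for all }\sigma\in G_0\text{ and all }x,y\in \mathrm{GF}(p^a)\}$$ be the centralizer algebra with respect to the base vertex $0$, a subalgebra of the algebra of complex matrices with rows and columns indexed by $\mathrm{GF}(p^a)$. Then $$\dim_{\mathbb C}\mathcal T_4(\mathrm{Paley}(p^a))\le 2p^a+3.$$ If $a=1$, then equality holds, $\dim_{\mathbb C}\mathcal T_4(\mathrm{Paley}(p))=2p+3$, and there is an isomorphism of $\mathbb C$-algebras $$\mathcal T_4(\mathrm{Paley}(p))\cong M_3(\mathbb C)\oplus\bigoplus_{i=1}^{(p-3)/2}M_2(\mathbb C).$$ -/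

import Mathlib

/-- The Paley graph on a finite field `F` with `|F| ≡ 1 (mod 4)`: the vertices are the elements of
`F`, and `x`, `y` are adjacent exactly when `y - x` is a nonzero square. -/
def paleyGraph (F : Type*) [Field F] [Fintype F] (hF : Fintype.card F % 4 = 1) :
    SimpleGraph F where
  Adj x y := x ≠ y ∧ IsSquare (y - x)
  symm := by
    refine ⟨fun x y h => ⟨h.1.symm, ?_⟩⟩
    have h1 : IsSquare (-1 : F) := by
      rw [FiniteField.isSquare_neg_one_iff]
      omega
    have h2 := h1.mul h.2
    rwa [neg_one_mul, neg_sub] at h2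
  loopless := ⟨fun x h => h.1 rfl⟩

/-- The centralizer algebra `T₄(Γ, x₀)`: the complex matrices indexed by the vertices that are
fixed by every automorphism `σ` of the graph `Γ` with `σ x₀ = x₀`, where an automorphism acts on
matrices by permuting rows and columns simultaneously. -/
def centralizerAlgebra {X : Type*} [Fintype X] [DecidableEq X] (Γ : SimpleGraph X) (x₀ : X) :
    Subalgebra ℂ (Matrix X X ℂ) where
  carrier := {M | ∀ σ : Γ ≃g Γ, σ x₀ = x₀ → M.submatrix σ σ = M}
  mul_mem' := by
    intro M N hM hN σ hσ
    have h := Matrix.submatrix_mul_equiv M N (⇑σ) σ.toEquiv (⇑σ)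
    have e : (⇑σ.toEquiv : X → X) = ⇑σ := rfl
    rw [e, hM σ hσ, hN σ hσ] at h
    exact h.symm
  add_mem' := by
    intro M N hM hN σ hσ
    rw [Matrix.submatrix_add, Pi.add_apply, Pi.add_apply, hM σ hσ, hN σ hσ]
  algebraMap_mem' := by
    intro c σ _
    ext x y
    simp [Matrix.algebraMap_matrix_apply]

/-!
A matrix commuting with every multiplication `x ↦ w ^ d * x`, `w ∈ Fˣ`, is block diagonal in a basis
of joint eigenvectors of these permutations. The multiplicative characters `χ` of `F`, extended by
zero, are eigenvectors with eigenvalue `χ w ^ d`, and together with the constant function `1` they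
form a basis. If `d ∣ |F| - 1`, each `d`-th power of a character therefore gives one block, of size
`d`, except that the constant function enlarges the block of the trivial character to `d + 1`. The
case `d = 2` gives the dimension bound, since multiplications by nonzero squares are automorphisms
of the Paley graph.

When `q = |F|` is prime there are no other automorphisms `f` fixing `0` (Carlitz). The slopes of `f`
are all nonzero squares, so `x ↦ f x - c * x` permutes `F` for the more than `q / 2` other values
of `c`. The power sums of these permutations give `∑ x, x ^ i * f x ^ j = 0` for `i + j ≤ q / 2`. If
the interpolation polynomial of `f` had degree at least `2`, some `x ^ i * f x ^ j` in this range
would have degree exactly `q - 1` and its sum would not vanish. So `f` is linear.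
-/

section PowerSums

open Polynomial

variable {K : Type*} [Field K] [Fintype K]

theorem coeff_C_mul_X_add_C_pow {R : Type*} [CommSemiring R] (a b : R) (n i : ℕ) :
    ((C a * X + C b) ^ n).coeff i = a ^ i * b ^ (n - i) * n.choose i := by
  have hcomp : (C a * X + C b) ^ n = ((X + C b) ^ n).comp (C a * X) := by simp
  rw [hcomp, comp_C_mul_X_coeff, coeff_X_add_C_pow]
  ring

variable (K) in
theorem sum_pow_card_sub_one : ∑ x : K, x ^ (Fintype.card K - 1) = -1 := by
  classical
  have hpow (x : K) : x ^ (Fintype.card K - 1) = 1 - if x = 0 then 1 else 0 := by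
    split_ifs with hx
    · rw [hx, zero_pow (Nat.sub_pos_of_lt Fintype.one_lt_card).ne', sub_self]
    · rw [FiniteField.pow_card_sub_one_eq_one x hx, sub_zero]
  simp [hpow]

theorem sum_eval_eq_neg_coeff {P : K[X]} (hP : P.natDegree < Fintype.card K) :
    ∑ x, P.eval x = -P.coeff (Fintype.card K - 1) := by
  obtain ⟨N, hN⟩ := Nat.exists_eq_succ_of_ne_zero (Fintype.card_ne_zero (α := K))
  have hlow : ∀ i ∈ Finset.range N, P.coeff i * ∑ x : K, x ^ i = 0 := fun i hi => by
    rw [FiniteField.sum_pow_lt_card_sub_one K i (by simpa [hN] using hi), mul_zero]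
  have htop : ∑ x : K, x ^ N = -1 := by simpa [hN] using sum_pow_card_sub_one K
  simp_rw [eval_eq_sum_range' (hN ▸ hP)]
  rw [Finset.sum_comm]
  simp_rw [← Finset.mul_sum]
  rw [Finset.sum_range_succ, Finset.sum_eq_zero hlow, zero_add, htop, mul_neg_one, hN,
    Nat.succ_sub_one]

theorem sum_pow_mul_pow_eq_zero_of_injective {f : K → K} {S : Finset K}
    (hf : ∀ c ∈ S, Function.Injective fun x => f x - c * x) {i j : ℕ} (hC : i + j < S.card)
    (hij : i + j < Fintype.card K - 1) (hchoose : ((i + j).choose i : K) ≠ 0) :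
    ∑ x, x ^ i * f x ^ j = 0 := by
  -- Every `c ∈ S` is a root of `Q`, because the values `f x - c * x` exhaust `K`.
  let Q : K[X] := ∑ x, (C (-x) * X + C (f x)) ^ (i + j)
  have hQdeg : Q.degree < S.card := by
    refine (degree_le_of_natDegree_le ?_).trans_lt (Nat.cast_lt.mpr hC)
    refine natDegree_sum_le_of_forall_le _ _ fun x _ => ?_
    exact (natDegree_pow_le_of_le _ natDegree_linear_le).trans_eq (mul_one _)
  have hQeval : ∀ c ∈ S, Q.eval c = 0 := fun c hc => by
    have hbij : Function.Bijective fun x => f x - c * x :=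
      Finite.injective_iff_bijective.mp (hf c hc)
    calc Q.eval c = ∑ x, (f x - c * x) ^ (i + j) := by
          rw [eval_finsetSum]
          refine Finset.sum_congr rfl fun x _ => ?_
          simp only [eval_pow, eval_add, eval_mul, eval_C, eval_X]
          ring
      _ = ∑ y : K, y ^ (i + j) := hbij.sum_comp (fun y => y ^ (i + j))
      _ = 0 := FiniteField.sum_pow_lt_card_sub_one K _ hij
  have hQcoeff : Q.coeff i = (-1) ^ i * (i + j).choose i * ∑ x, x ^ i * f x ^ j := by
    rw [finsetSum_coeff, Finset.mul_sum]
    refine Finset.sum_congr rfl fun x _ => ?_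
    rw [coeff_C_mul_X_add_C_pow, neg_pow, Nat.add_sub_cancel_left]
    ring
  rw [eq_zero_of_degree_lt_of_eval_finset_eq_zero S hQdeg hQeval, coeff_zero] at hQcoeff
  exact (mul_eq_zero.mp hQcoeff.symm).resolve_left
    (mul_ne_zero (pow_ne_zero _ (neg_ne_zero.mpr one_ne_zero)) hchoose)

theorem exists_add_mul_eq_of_two_le {d N : ℕ} (hd : 2 ≤ d) (hdN : d ≤ N) :
    ∃ i j, i + j * d = N ∧ 2 * (i + j) ≤ N + 1 := by
  refine ⟨N % d, N / d, Nat.mod_add_div' N d, ?_⟩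
  obtain ⟨e, rfl⟩ := Nat.exists_eq_add_of_le' hd
  have hmod : N % (e + 2) < e + 2 := Nat.mod_lt _ (by omega)
  have hdiv : 1 ≤ N / (e + 2) := Nat.div_pos hdN (by omega)
  have heq := Nat.mod_add_div' N (e + 2)
  nlinarith

theorem natDegree_le_one_of_sum_pow_mul_eval_pow_eq_zero {P : K[X]}
    (hP : P.natDegree < Fintype.card K)
    (hsum : ∀ i j, i + j ≤ Fintype.card K / 2 → ∑ x, x ^ i * P.eval x ^ j = 0) :
    P.natDegree ≤ 1 := by
  by_contra! hdeg
  have hP0 : P ≠ 0 := ne_zero_of_natDegree_gt hdeg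
  obtain ⟨i, j, hij, hle⟩ := exists_add_mul_eq_of_two_le hdeg (Nat.le_sub_one_of_lt hP)
  have hnatDegree : (X ^ i * P ^ j).natDegree = Fintype.card K - 1 := by
    rw [natDegree_mul (pow_ne_zero _ X_ne_zero) (pow_ne_zero _ hP0), natDegree_X_pow,
      natDegree_pow, hij]
  have hlead : ∑ x, (X ^ i * P ^ j).eval x = -(X ^ i * P ^ j).leadingCoeff := by
    rw [sum_eval_eq_neg_coeff (by omega), ← hnatDegree, coeff_natDegree]
  simp only [eval_mul, eval_pow, eval_X, hsum i j (by omega), zero_eq_neg, leadingCoeff_eq_zero]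
    at hlead
  exact mul_ne_zero (pow_ne_zero i X_ne_zero) (pow_ne_zero j hP0) hlead

theorem natCast_choose_ne_zero_of_lt {R : Type*} [AddMonoidWithOne R] (p : ℕ) [CharP R p]
    (hp : p.Prime) {n k : ℕ} (hn : n < p) (hk : k ≤ n) : (n.choose k : R) ≠ 0 := by
  rw [Ne, CharP.cast_eq_zero_iff R p]
  intro hdvd
  have hfact : p ∣ n.factorial := by
    rw [← Nat.choose_mul_factorial_mul_factorial hk, mul_assoc]
    exact hdvd.mul_right _
  exact (hp.dvd_factorial.mp hfact).not_gt hn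

theorem exists_eq_mul_add_of_slope_mem (hK : (Fintype.card K).Prime) {f : K → K} {D : Finset K}
    (hD : 2 * D.card < Fintype.card K) (hf : ∀ x y, x ≠ y → slope f x y ∈ D) :
    ∃ a b, ∀ x, f x = a * x + b := by
  classical
  have : Fact (Fintype.card K).Prime := ⟨hK⟩
  have : CharP K (Fintype.card K) := charP_of_card_eq_prime rfl
  have hDpos : 0 < D.card := Finset.card_pos.mpr ⟨_, hf 0 1 zero_ne_one⟩
  have hinj : ∀ c ∈ Dᶜ, Function.Injective fun x => f x - c * x := fun c hc x y hxy => by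
    by_contra hne
    have hslope : slope f x y = c := by
      rw [slope_def_field, div_eq_iff (sub_ne_zero.mpr (Ne.symm hne))]
      linear_combination -hxy
    exact Finset.mem_compl.mp hc (hslope ▸ hf x y hne)
  have hsum : ∀ i j, i + j ≤ Fintype.card K / 2 → ∑ x, x ^ i * f x ^ j = 0 := fun i j hij =>
    sum_pow_mul_pow_eq_zero_of_injective hinj (by rw [Finset.card_compl]; omega) (by omega)
      (natCast_choose_ne_zero_of_lt (Fintype.card K) hK (by omega) (by omega))
  let P := Lagrange.interpolate Finset.univ id f
  have hnodes : Set.InjOn (id : K → K) (Finset.univ : Finset K) := Function.injective_id.injOn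
  have hPeval (x : K) : P.eval x = f x :=
    Lagrange.eval_interpolate_at_node f hnodes (Finset.mem_univ x)
  have hPdeg : P.natDegree < Fintype.card K := by
    rcases eq_or_ne P 0 with hP0 | hP0
    · simpa only [hP0, natDegree_zero] using Fintype.card_pos
    · exact (natDegree_lt_iff_degree_lt hP0).mpr (Lagrange.degree_interpolate_lt f hnodes)
  have hPlin : P.natDegree ≤ 1 :=
    natDegree_le_one_of_sum_pow_mul_eval_pow_eq_zero hPdeg (by simpa only [hPeval] using hsum)
  refine ⟨P.coeff 1, P.coeff 0, fun x => ?_⟩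
  rw [← hPeval, eq_X_add_C_of_natDegree_le_one hPlin]
  simp

theorem two_mul_card_quadraticChar_eq_one_lt [DecidableEq K] (hK : ringChar K ≠ 2) :
    2 * (Finset.univ.filter fun c : K => quadraticChar K c = 1).card < Fintype.card K := by
  have hodd : Fintype.card K % 2 = 1 := FiniteField.odd_card_of_char_ne_two hK
  have hsub : (Finset.univ.filter fun c : K => quadraticChar K c = 1) ⊆
      (nthRoots (Fintype.card K / 2) (1 : K)).toFinset := fun c hc => by
    have hpos : 0 < Fintype.card K / 2 := Nat.div_pos Fintype.one_lt_card two_pos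
    rw [Multiset.mem_toFinset, mem_nthRoots hpos, ← quadraticChar_eq_pow_of_char_ne_two' hK,
      (Finset.mem_filter.mp hc).2, Int.cast_one]
  have := (Finset.card_le_card hsub).trans
    ((Multiset.toFinset_card_le _).trans (card_nthRoots _ 1))
  omega

theorem exists_eq_mul_add_of_quadraticChar_sub [DecidableEq K] (hK : (Fintype.card K).Prime)
    (hchar : ringChar K ≠ 2) {f : K → K}
    (hf : ∀ x y, quadraticChar K (f y - f x) = quadraticChar K (y - x)) :
    ∃ a b, ∀ x, f x = a * x + b := by
  refine exists_eq_mul_add_of_slope_mem hK (two_mul_card_quadraticChar_eq_one_lt hchar)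
    fun x y hxy => Finset.mem_filter.mpr ⟨Finset.mem_univ _, ?_⟩
  have hyx : y - x ≠ 0 := sub_ne_zero.mpr hxy.symm
  refine mul_right_cancel₀ (quadraticChar_eq_zero_iff.not.mpr hyx) ?_
  rw [← map_mul, slope_def_field, div_mul_cancel₀ _ hyx, hf, one_mul]

end PowerSums

section Paley

variable {F : Type*} [Field F] [Fintype F] {hF : Fintype.card F % 4 = 1}

theorem paleyGraph_adj_iff [DecidableEq F] {x y : F} :
    (paleyGraph F hF).Adj x y ↔ quadraticChar F (y - x) = 1 := by
  rcases eq_or_ne x y with rfl | hxy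
  · simp
  · rw [quadraticChar_one_iff_isSquare (sub_ne_zero.mpr hxy.symm)]
    exact and_iff_right hxy

theorem quadraticChar_paleyGraph_iso_sub [DecidableEq F] (σ : paleyGraph F hF ≃g paleyGraph F hF)
    (x y : F) : quadraticChar F (σ y - σ x) = quadraticChar F (y - x) := by
  rcases eq_or_ne x y with rfl | hxy
  · rw [sub_self, sub_self]
  have hadj : quadraticChar F (σ y - σ x) = 1 ↔ quadraticChar F (y - x) = 1 := by
    rw [← paleyGraph_adj_iff (hF := hF), ← paleyGraph_adj_iff (hF := hF), σ.map_adj_iff]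
  have h₁ := quadraticChar_dichotomy (sub_ne_zero.mpr hxy.symm)
  have h₂ := quadraticChar_dichotomy (sub_ne_zero.mpr (σ.injective.ne hxy.symm))
  grind

/-- Multiplication by a nonzero square, as an automorphism of the Paley graph fixing `0`. -/
def paleyGraphSqSMul (w : Fˣ) : paleyGraph F hF ≃g paleyGraph F hF where
  toEquiv := MulAction.toPerm (w ^ 2)
  map_rel_iff' {x y} := by
    classical
    rw [paleyGraph_adj_iff, paleyGraph_adj_iff, MulAction.toPerm_apply, MulAction.toPerm_apply,
      ← smul_sub, Units.smul_def, smul_eq_mul, map_mul, Units.val_pow_eq_pow_val,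
      quadraticChar_sq_one' w.ne_zero, one_mul]

theorem exists_paleyGraph_iso_eq_sq_smul (hF' : (Fintype.card F).Prime)
    (σ : paleyGraph F hF ≃g paleyGraph F hF) (hσ : σ 0 = 0) :
    ∃ w : Fˣ, ∀ x, σ x = w ^ 2 • x := by
  classical
  have hchar : ringChar F ≠ 2 := fun h => by
    have := FiniteField.even_card_of_char_two h
    omega
  obtain ⟨a, b, hab⟩ := exists_eq_mul_add_of_quadraticChar_sub hF' hchar
    (quadraticChar_paleyGraph_iso_sub σ)
  have hb : b = 0 := by simpa [hσ] using (hab 0).symm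
  have ha : quadraticChar F a = 1 := by
    simpa [hab, hb] using quadraticChar_paleyGraph_iso_sub σ 0 1
  have ha0 : a ≠ 0 := fun h => by simp [h] at ha
  obtain ⟨w, rfl⟩ := (isSquare_iff_exists_sq _).mp ((quadraticChar_one_iff_isSquare ha0).mp ha)
  refine ⟨Units.mk0 w ((pow_ne_zero_iff two_ne_zero).mp ha0), fun x => ?_⟩
  rw [hab, hb, add_zero, Units.smul_def, smul_eq_mul, Units.val_pow_eq_pow_val, Units.val_mk0]

end Paley

theorem subalgebra_map_centralizer {R A B : Type*} [CommSemiring R] [Semiring A] [Semiring B]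
    [Algebra R A] [Algebra R B] (e : A ≃ₐ[R] B) (s : Set A) :
    (Subalgebra.centralizer R s).map (e : A →ₐ[R] B) = Subalgebra.centralizer R (e '' s) := by
  ext b
  obtain ⟨a, rfl⟩ := e.surjective b
  simp [Subalgebra.mem_centralizer_iff, ← map_mul]

section BlockMatrices

variable {κ R : Type*} {m : κ → Type*} [Fintype κ] [∀ k, Fintype (m k)] [∀ k, DecidableEq (m k)]

section CommSemiring

variable [CommSemiring R]

theorem nonempty_pi_matrix_algEquiv_prod {r s n : ℕ} (k₀ : κ) (hr : Fintype.card (m k₀) = r)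
    (hs : ∀ k, k ≠ k₀ → Fintype.card (m k) = s) (hn : Fintype.card κ = n + 1) :
    Nonempty ((∀ k, Matrix (m k) (m k) R) ≃ₐ[R]
      Matrix (Fin r) (Fin r) R × (Fin n → Matrix (Fin s) (Fin s) R)) := by
  classical
  let size : Option (Fin n) → ℕ := fun o => o.elim r fun _ => s
  obtain ⟨e, he⟩ : ∃ e : Option (Fin n) ≃ κ, e none = k₀ := by
    have e : Fin n ≃ {k // k ≠ k₀} := Fintype.equivOfCardEq (by
      simp [Fintype.card_subtype_compl, hn])
    exact ⟨e.optionCongr.trans (Equiv.optionSubtypeNe k₀), by simp⟩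
  have hsize (o : Option (Fin n)) : Fintype.card (m (e o)) = Fintype.card (Fin (size o)) := by
    cases o with
    | none => rw [he, hr, Fintype.card_fin]; rfl
    | some i => rw [hs _ (he ▸ e.injective.ne (Option.some_ne_none i)), Fintype.card_fin]; rfl
  let reorder := (AlgEquiv.piCongrLeft R (fun k => Matrix (m k) (m k) R) e).symm
  let relabel := AlgEquiv.piCongrRight fun o =>
    Matrix.reindexAlgEquiv R R (Fintype.equivOfCardEq (hsize o))
  let splitNone : (∀ o, Matrix (Fin (size o)) (Fin (size o)) R) ≃ₐ[R]
      Matrix (Fin r) (Fin r) R × (Fin n → Matrix (Fin s) (Fin s) R) :=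
    AlgEquiv.ofRingEquiv (f := RingEquiv.piOptionEquivProd) fun _ => rfl
  exact ⟨reorder.trans (relabel.trans splitNone)⟩

variable [DecidableEq κ]

variable (R m) in
/-- Assembling square blocks into a block diagonal matrix, as an algebra homomorphism; this is
`Matrix.blockDiagonal'RingHom` with its linearity. -/
def blockDiagonalAlgHom :
    (∀ k, Matrix (m k) (m k) R) →ₐ[R] Matrix (Σ k, m k) (Σ k, m k) R where
  __ := Matrix.blockDiagonal'RingHom m R
  commutes' r := Matrix.blockDiagonal'_diagonal fun _ _ => r

theorem blockDiagonalAlgHom_injective : Function.Injective (blockDiagonalAlgHom R m) :=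
  Matrix.blockDiagonal'_injective

theorem mem_range_blockDiagonalAlgHom {M : Matrix (Σ k, m k) (Σ k, m k) R} :
    M ∈ (blockDiagonalAlgHom R m).range ↔ ∀ x y, x.1 ≠ y.1 → M x y = 0 := by
  refine ⟨?_, fun hM => ⟨Matrix.blockDiag' M, ?_⟩⟩
  · rintro ⟨A, rfl⟩ x y hxy
    exact Matrix.blockDiagonal'_apply_ne A x.2 y.2 hxy
  · ext ⟨k, i⟩ ⟨l, j⟩
    rcases eq_or_ne k l with rfl | hkl
    · exact Matrix.blockDiagonal'_apply_eq _ k i j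
    · exact (Matrix.blockDiagonal'_apply_ne _ i j hkl).trans (hM _ _ hkl).symm

end CommSemiring

variable [CommRing R] [DecidableEq κ]

theorem diagonal_mul_eq_mul_diagonal_iff {ι : Type*} [Fintype ι] [DecidableEq ι] {v : ι → R}
    {M : Matrix ι ι R} :
    Matrix.diagonal v * M = M * Matrix.diagonal v ↔ ∀ i j, (v i - v j) * M i j = 0 := by
  simp only [← Matrix.ext_iff, Matrix.diagonal_mul, Matrix.mul_diagonal, sub_mul, sub_eq_zero,
    mul_comm (M _ _)]

theorem centralizer_diagonal_eq_range_blockDiagonalAlgHom [NoZeroDivisors R] {G : Type*}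
    {d : κ → G → R} (hd : Function.Injective d) :
    Subalgebra.centralizer R (Set.range fun g => Matrix.diagonal fun x : Σ k, m k => d x.1 g) =
      (blockDiagonalAlgHom R m).range := by
  ext M
  simp only [Subalgebra.mem_centralizer_iff, Set.forall_mem_range, diagonal_mul_eq_mul_diagonal_iff,
    mem_range_blockDiagonalAlgHom, mul_eq_zero, sub_eq_zero]
  refine ⟨fun hM x y hxy => ?_, fun hM g x y => ?_⟩
  · obtain ⟨g, hg⟩ := Function.ne_iff.mp (hd.ne hxy)
    exact (hM g x y).resolve_left hg
  · exact or_iff_not_imp_left.mpr fun hne => hM x y (mt (congrArg (d · g)) hne)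

theorem nonempty_centralizer_algEquiv_pi_matrix [NoZeroDivisors R] {A G : Type*} [Ring A]
    [Algebra R A] (e : A ≃ₐ[R] Matrix (Σ k, m k) (Σ k, m k) R) {T : G → A} {d : κ → G → R}
    (hd : Function.Injective d) (hT : ∀ g, e (T g) = Matrix.diagonal fun x => d x.1 g) :
    Nonempty (Subalgebra.centralizer R (Set.range T) ≃ₐ[R] ∀ k, Matrix (m k) (m k) R) := by
  have hmap : (Subalgebra.centralizer R (Set.range T)).map (e : A →ₐ[R] _) =
      (blockDiagonalAlgHom R m).range := by
    rw [subalgebra_map_centralizer, ← Set.range_comp,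
      ← centralizer_diagonal_eq_range_blockDiagonalAlgHom hd]
    simp only [Function.comp_def, hT]
  exact ⟨(e.subalgebraMap _).trans <| (Subalgebra.equivOfEq _ _ hmap).trans
    (AlgEquiv.ofInjective _ blockDiagonalAlgHom_injective).symm⟩

end BlockMatrices

theorem permMatrix_mul_eq_mul_permMatrix_iff {ι R : Type*} [Fintype ι] [DecidableEq ι]
    [NonAssocSemiring R] {σ : Equiv.Perm ι} {M : Matrix ι ι R} :
    σ.permMatrix R * M = M * σ.permMatrix R ↔ M.submatrix σ σ = M := by
  rw [Equiv.Perm.permMatrix, PEquiv.toMatrix_toPEquiv_mul, PEquiv.mul_toMatrix_toPEquiv,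
    ← Matrix.ext_iff, ← Matrix.ext_iff]
  refine forall_congr' fun i => σ.forall_congr_right.symm.trans ?_
  simp only [Matrix.submatrix_apply, id, Equiv.symm_apply_apply]

theorem isCyclic_mulChar (M R : Type*) [CommMonoid M] [Finite M] [IsCyclic Mˣ] [CommRing R]
    [HasEnoughRootsOfUnity R (Monoid.exponent Mˣ)] : IsCyclic (MulChar M R) :=
  let ⟨e⟩ := MulChar.mulEquiv_units M R
  e.isCyclic.mpr inferInstance

section CharacterBasis

open scoped Matrix

section CommMonoidWithZero

variable {F K : Type*} [CommMonoidWithZero F] [CommMonoidWithZero K]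

/-- The multiplicative functions `F → K`: a multiplicative character of `F`, which vanishes
at `0`, or (for `none`) the constant function `1`. -/
def optionMulCharHom (o : Option (MulChar F K)) : F →* K :=
  o.elim 1 MulChar.toMonoidHom

theorem optionMulCharHom_injective [Nontrivial F] [Nontrivial K] :
    Function.Injective (optionMulCharHom : Option (MulChar F K) → F →* K) := by
  have hzero (χ : MulChar F K) : (1 : F →* K) ≠ χ.toMonoidHom := fun h =>
    one_ne_zero ((DFunLike.congr_fun h 0).trans (MulChar.map_zero χ))
  rintro (_ | χ) (_ | ψ) h
  · rfl
  · exact absurd h (hzero ψ)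
  · exact absurd h.symm (hzero χ)
  · exact congrArg some (MulChar.ext fun u => DFunLike.congr_fun h (u : F))

/-- The power `χ ^ d` (`1` for `none`): its value at `w` is the eigenvalue of `x ↦ w ^ d • x` on
`optionMulCharHom o`, so its fibres index the joint eigenspaces. -/
noncomputable def powBlock (d : ℕ) (o : Option (MulChar F K)) :
    (powMonoidHom d : MulChar F K →* MulChar F K).range :=
  (powMonoidHom d).rangeRestrict (o.getD 1)

theorem optionMulCharHom_pow_smul (o : Option (MulChar F K)) (d : ℕ) (w : Fˣ) (x : F) :
    optionMulCharHom o (w ^ d • x) = (powBlock d o).1 w * optionMulCharHom o x := by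
  rw [Units.smul_def, smul_eq_mul, map_mul, Units.val_pow_eq_pow_val, map_pow]
  cases o with
  | none => simp [optionMulCharHom, powBlock, MulChar.one_apply_coe]
  | some χ => simp [optionMulCharHom, powBlock, MulChar.pow_apply_coe]

end CommMonoidWithZero

section CommRing

variable {F K : Type*} [CommMonoidWithZero F] [CommRing K]

theorem permMatrix_toPerm_pow_mulVec_optionMulCharHom [Fintype F] [DecidableEq F]
    (o : Option (MulChar F K)) (d : ℕ) (w : Fˣ) :
    (MulAction.toPerm (w ^ d) : Equiv.Perm F).permMatrix K *ᵥ optionMulCharHom o =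
      (powBlock d o).1 w • (optionMulCharHom o : F → K) := by
  rw [Matrix.permMatrix_mulVec]
  exact funext (optionMulCharHom_pow_smul o d w)

theorem linearIndependent_optionMulCharHom [Nontrivial F] [IsDomain K] :
    LinearIndependent K fun o : Option (MulChar F K) => (optionMulCharHom o : F → K) :=
  (linearIndependent_monoidHom F K).comp _ optionMulCharHom_injective

end CommRing

variable {F K : Type*} [Field F] [Finite F] [Field K]
  [HasEnoughRootsOfUnity K (Monoid.exponent Fˣ)]

theorem exists_basis_coe_eq_optionMulCharHom :
    ∃ b : Module.Basis (Option (MulChar F K)) K (F → K), ∀ o, b o = optionMulCharHom o := by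
  have := Fintype.ofFinite F
  have := Fintype.ofFinite (MulChar F K)
  have hcard : Fintype.card (Option (MulChar F K)) = Module.finrank K (F → K) := by
    rw [Module.finrank_fintype_fun_eq_card, Fintype.card_option, ← Nat.card_eq_fintype_card,
      MulChar.card_eq_card_units_of_hasEnoughRootsOfUnity, ← Nat.card_eq_card_units_add_one,
      Nat.card_eq_fintype_card]
  exact ⟨basisOfLinearIndependentOfCardEqFinrank linearIndependent_optionMulCharHom hcard,
    fun o => by simp⟩

end CharacterBasis

theorem card_option_getD_fiber {G H : Type*} [Group G] [Group H] [Finite G] [DecidableEq H]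
    {f : G →* H} (hf : Function.Surjective f) (h : H) :
    Nat.card {o : Option G // f (o.getD 1) = h} = (if h = 1 then 1 else 0) + Nat.card f.ker := by
  have := Fintype.ofFinite G
  have hfiber : Fintype.card {g // f g = h} = Nat.card f.ker := by
    rw [← Nat.card_eq_fintype_card]
    exact Nat.card_congr (f.fiberEquivKerOfSurjective hf h)
  rw [Nat.card_eq_fintype_card, Fintype.card_subtype, Finset.card_filter, Fintype.sum_option,
    ← hfiber, Fintype.card_subtype, Finset.card_filter]
  simp [eq_comm]

theorem toMatrixAlgEquiv_eq_diagonal {ι R M : Type*} [Fintype ι] [DecidableEq ι] [CommSemiring R]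
    [AddCommMonoid M] [Module R M] (b : Module.Basis ι R M) {T : Module.End R M} {v : ι → R}
    (hT : ∀ i, T (b i) = v i • b i) : LinearMap.toMatrixAlgEquiv b T = Matrix.diagonal v := by
  ext i j
  rw [LinearMap.toMatrixAlgEquiv_apply, hT, map_smul, b.repr_self, Finsupp.smul_single_one,
    Finsupp.single_apply, Matrix.diagonal_apply]
  grind

section PowerCommutant

variable (F K : Type*) [Field F] [Fintype F] [DecidableEq F] [Field K] (d : ℕ)

/-- The `F × F` matrices over `K` commuting with the permutations `x ↦ w ^ d * x`, `w ∈ Fˣ`. -/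
def powerCommutant : Subalgebra K (Matrix F F K) :=
  Subalgebra.centralizer K
    (Set.range fun w : Fˣ => (MulAction.toPerm (w ^ d) : Equiv.Perm F).permMatrix K)

variable {F K d}

theorem mem_powerCommutant_iff {M : Matrix F F K} :
    M ∈ powerCommutant F K d ↔ ∀ w : Fˣ, M.submatrix (w ^ d • ·) (w ^ d • ·) = M := by
  simp only [powerCommutant, Subalgebra.mem_centralizer_iff, Set.forall_mem_range,
    permMatrix_mul_eq_mul_permMatrix_iff]
  rfl

variable [HasEnoughRootsOfUnity K (Monoid.exponent Fˣ)]

theorem nonempty_powerCommutant_algEquiv_pi_matrix [Fintype (MulChar F K)]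
    [DecidableEq (MulChar F K)] :
    Nonempty (powerCommutant F K d ≃ₐ[K] ∀ ψ, Matrix {o : Option (MulChar F K) // powBlock d o = ψ}
      {o : Option (MulChar F K) // powBlock d o = ψ} K) := by
  have := Fintype.ofFinite (powMonoidHom d : MulChar F K →* MulChar F K).range
  obtain ⟨b, hb⟩ := exists_basis_coe_eq_optionMulCharHom (F := F) (K := K)
  let b' := b.reindex (Equiv.sigmaFiberEquiv (powBlock d)).symm
  let e := Matrix.toLinAlgEquiv'.trans (LinearMap.toMatrixAlgEquiv b')
  refine nonempty_centralizer_algEquiv_pi_matrix e (d := fun ψ (w : Fˣ) => ψ.1 w)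
    (fun ψ₁ ψ₂ h => Subtype.ext (MulChar.ext (congrFun h)))
    fun w => toMatrixAlgEquiv_eq_diagonal b' fun ⟨ψ, o, ho⟩ => ?_
  subst ho
  have hb' : b' ⟨powBlock d o, o, rfl⟩ = optionMulCharHom o := by
    rw [b.reindex_apply, ← hb]
    rfl
  rw [hb']
  exact permMatrix_toPerm_pow_mulVec_optionMulCharHom o d w

theorem nonempty_powerCommutant_algEquiv {n : ℕ} (hn : Fintype.card F = (n + 1) * d + 1) :
    Nonempty (powerCommutant F K d ≃ₐ[K]
      Matrix (Fin (d + 1)) (Fin (d + 1)) K × (Fin n → Matrix (Fin d) (Fin d) K)) := by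
  classical
  have := isCyclic_mulChar F K
  have := Fintype.ofFinite (MulChar F K)
  let f : MulChar F K →* MulChar F K := powMonoidHom d
  have hcard : Nat.card (MulChar F K) = (n + 1) * d := by
    rw [MulChar.card_eq_card_units_of_hasEnoughRootsOfUnity, Nat.card_units,
      Nat.card_eq_fintype_card, hn, Nat.add_sub_cancel]
  have hd : 0 < d := Nat.pos_of_mul_pos_left (hcard ▸ Nat.card_pos)
  have hker : Nat.card f.rangeRestrict.ker = d := by
    rw [f.ker_rangeRestrict, IsCyclic.card_powMonoidHom_ker, hcard, Nat.gcd_mul_left_left]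
  have hrange : Fintype.card f.range = n + 1 := by
    rw [← Nat.card_eq_fintype_card, IsCyclic.card_powMonoidHom_range, hcard,
      Nat.gcd_mul_left_left, Nat.mul_div_cancel _ hd]
  have hblock (ψ : f.range) :
      Fintype.card {o // powBlock d o = ψ} = (if ψ = 1 then 1 else 0) + d := by
    rw [← Nat.card_eq_fintype_card]
    exact (card_option_getD_fiber f.rangeRestrict_surjective ψ).trans (by rw [hker])
  obtain ⟨e₁⟩ := nonempty_powerCommutant_algEquiv_pi_matrix (F := F) (K := K) (d := d)
  obtain ⟨e₂⟩ := nonempty_pi_matrix_algEquiv_prod (R := K) (r := d + 1) (s := d)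
    (m := fun ψ : f.range => {o // powBlock d o = ψ}) 1
    (by rw [hblock, if_pos rfl, add_comm])
    (fun ψ hψ => by rw [hblock, if_neg hψ, zero_add]) hrange
  exact ⟨e₁.trans e₂⟩

theorem finrank_powerCommutant (hd : d ∣ Fintype.card F - 1) :
    Module.finrank K (powerCommutant F K d) = d * Fintype.card F + d + 1 := by
  obtain ⟨_ | n, hn⟩ := hd
  · have := Fintype.one_lt_card (α := F)
    omega
  have hcard : Fintype.card F = (n + 1) * d + 1 := by
    have := Fintype.card_pos (α := F)
    rw [mul_comm]
    omega
  obtain ⟨e⟩ := nonempty_powerCommutant_algEquiv (K := K) hcard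
  rw [e.toLinearEquiv.finrank_eq, hcard]
  simp only [Module.finrank_prod, Module.finrank_matrix, Module.finrank_pi_fintype,
    Module.finrank_self, Fintype.card_fin, Finset.sum_const, Finset.card_univ, smul_eq_mul]
  ring

end PowerCommutant

section CentralizerAlgebra

variable {F : Type*} [Field F] [Fintype F] [DecidableEq F] {hF : Fintype.card F % 4 = 1}

theorem centralizerAlgebra_paleyGraph_le :
    centralizerAlgebra (paleyGraph F hF) 0 ≤ powerCommutant F ℂ 2 := fun _ hM =>
  mem_powerCommutant_iff.mpr fun w => hM (paleyGraphSqSMul w) (smul_zero (M := Fˣ) (w ^ 2))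

theorem centralizerAlgebra_paleyGraph_eq (hF' : (Fintype.card F).Prime) :
    centralizerAlgebra (paleyGraph F hF) 0 = powerCommutant F ℂ 2 := by
  refine centralizerAlgebra_paleyGraph_le.antisymm fun M hM σ hσ => ?_
  obtain ⟨w, hw⟩ := exists_paleyGraph_iso_eq_sq_smul hF' σ hσ
  rw [funext hw]
  exact mem_powerCommutant_iff.mp hM w

end CentralizerAlgebra

theorem mainTheorem7 (p a : ℕ) (hp : p.Prime) (F : Type*) [Field F] [Fintype F] [DecidableEq F]
    (hcard : Fintype.card F = p ^ a) (hF : Fintype.card F % 4 = 1) :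
    Module.finrank ℂ (centralizerAlgebra (paleyGraph F hF) 0) ≤ 2 * p ^ a + 3 ∧
    (a = 1 →
      Module.finrank ℂ (centralizerAlgebra (paleyGraph F hF) 0) = 2 * p + 3 ∧
      Nonempty (centralizerAlgebra (paleyGraph F hF) 0 ≃ₐ[ℂ]
        (Matrix (Fin 3) (Fin 3) ℂ × (Fin ((p - 3) / 2) → Matrix (Fin 2) (Fin 2) ℂ)))) := by
  have hfinrank : Module.finrank ℂ (powerCommutant F ℂ 2) = 2 * p ^ a + 3 :=
    hcard ▸ finrank_powerCommutant (by omega)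
  refine ⟨hfinrank ▸ Submodule.finrank_mono
    (Subalgebra.toSubmodule.monotone centralizerAlgebra_paleyGraph_le), ?_⟩
  rintro rfl
  rw [pow_one] at hcard hfinrank
  rw [centralizerAlgebra_paleyGraph_eq (hcard ▸ hp)]
  have := Fintype.one_lt_card (α := F)
  exact ⟨hfinrank, nonempty_powerCommutant_algEquiv (by omega)⟩
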